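/- For a nonnegative integer $n$, let $a_4(n)$ be the number of Carlitz multipermutations of $1^4,2^4,\ldots,n^4$, that is, of words of length $4n$ in which each of the letters $1,\ldots,n$ occurs exactly four times and any two adjacent letters are different. Then for every $n\ge 0$ \[ a_4(n)=\sum_{s+t+u+v+w=n}(-1)^{t+w}\binom{n}{s,t,u,v,w}\,\frac{(4s+3t+2u+2v+w)!}{(4!)^s\,(2!)^{v+t}}, \] where the sum is over all nonnegative integers $s,t,u,v,w$ with $s+t+u+v+w=n$. Equivalently, \[ a_4(n)=\Phi\left(\left(\frac{t^4}{24}-\frac{t^3}{2}+\frac{3t^2}{2}-t\right)^n\right), \] where $\Phi:\mathbb{Q}[t]\to\mathbb{Q}$ is the linear functional with $\Phi(t^m)=m!$ for all $m\ge 0$. -/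

import Mathlib

open scoped Nat Polynomial

/-- The Carlitz multipermutations of `1^k, 2^k, …, n^k`: words over an alphabet of `n` letters
in which every letter occurs exactly `k` times and adjacent letters are different. -/
def carlitzWords (k n : ℕ) : Set (List (Fin n)) :=
  {l | (∀ i, l.count i = k) ∧ l.IsChain (fun x y => x ≠ y)}

theorem carlitzWords_finite (k n : ℕ) : (carlitzWords k n).Finite := by
  refine (List.finite_length_eq (Fin n) (n * k)).subset ?_
  rintro l ⟨hl, -⟩
  have h := Multiset.sum_count_eq_card (s := Finset.univ) (m := (l : Multiset (Fin n)))
    (fun _ _ => Finset.mem_univ _)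
  simpa [hl] using h.symm

/-- The number `a_k(n)` of Carlitz multipermutations of `1^k, 2^k, …, n^k`. -/
noncomputable def carlitzCount (k n : ℕ) : ℕ := (carlitzWords k n).ncard

/-- The linear functional on polynomials that replaces each power `X ^ m` by `m!`. -/
noncomputable def factorialFunctional : ℚ[X] →ₗ[ℚ] ℚ :=
  (Polynomial.basisMonomials ℚ).constr ℚ (fun m => (m ! : ℚ))

theorem factorialFunctional_X_pow (m : ℕ) :
    factorialFunctional (Polynomial.X ^ m) = (m ! : ℚ) := by
  rw [Polynomial.X_pow_eq_monomial]
  simpa [factorialFunctional] using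
    (Polynomial.basisMonomials ℚ).constr_basis ℚ (fun m => (m ! : ℚ)) m

/-! Allow any content `m` and let `P_k` be `carlitzPoly k`. The number of Carlitz words is `Φ(∏ P_{m
i})`, and the number starting with `c` is the same expression with the factor `P_{m c}`
differentiated. Two facts match: deleting the first letter gives a recurrence that mirrors `P_{k+1}'
= P_k - P_k'`, and summing over first letters is the product rule, since `Φ(p') = Φ(p)` when `p(0) =
0`. Taking `m` constant gives `Φ(P_k ^ n)`; for `k = 4` the multinomial theorem gives the sum. -/

/-- The words over `α` in which the letter `i` occurs `m i` times and adjacent letters differ. -/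
def carlitzWordsOfContent {α : Type*} [DecidableEq α] (m : α → ℕ) : Set (List α) :=
  {l | (∀ i, l.count i = m i) ∧ l.IsChain (fun x y => x ≠ y)}

/-- The tails of the words in `carlitzWordsOfContent m` with first letter `c`. -/
def carlitzTails {α : Type*} [DecidableEq α] (m : α → ℕ) (c : α) : Set (List α) :=
  {l | c :: l ∈ carlitzWordsOfContent m}

/-! ### Recurrences from the first letter -/

section Words

variable {α : Type*} [DecidableEq α]

theorem carlitzWordsOfContent_finite [Fintype α] (m : α → ℕ) :
    (carlitzWordsOfContent m).Finite := by
  refine (List.finite_length_eq α (∑ i, m i)).subset ?_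
  rintro l ⟨hl, -⟩
  have h := Multiset.sum_count_eq_card (s := Finset.univ) (m := (l : Multiset α))
    (fun _ _ => Finset.mem_univ _)
  simpa [hl] using h.symm

theorem carlitzTails_finite [Fintype α] (m : α → ℕ) (c : α) : (carlitzTails m c).Finite :=
  (carlitzWordsOfContent_finite m).preimage (List.cons_injective.injOn)

theorem carlitzWordsOfContent_zero :
    carlitzWordsOfContent (fun _ : α => 0) = {[]} := by
  ext l
  constructor
  · rintro ⟨h, -⟩
    exact List.eq_nil_iff_forall_not_mem.2 fun a => List.count_eq_zero.1 (h a)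
  · rintro rfl
    simp [carlitzWordsOfContent]

theorem carlitzTails_eq_empty {m : α → ℕ} {c : α} (h : m c = 0) : carlitzTails m c = ∅ := by
  ext l
  simp only [Set.mem_empty_iff_false, iff_false]
  rintro ⟨hl, -⟩
  have := hl c
  simp [h] at this

/-- After deleting the leading `c`, the only obstruction to putting it back is a word that again
starts with `c`. -/
theorem carlitzTails_eq_diff {m : α → ℕ} {c : α} {k : ℕ} (h : m c = k + 1) :
    carlitzTails m c = carlitzWordsOfContent (Function.update m c k) \
      (List.cons c '' carlitzTails (Function.update m c k) c) := by
  have hcount (l : List α) :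
      (∀ i, (c :: l).count i = m i) ↔ ∀ i, l.count i = Function.update m c k i := by
    refine forall_congr' fun i => ?_
    by_cases hi : i = c
    · subst hi
      simp [h]
    · simp [hi, Ne.symm hi]
  ext l
  simp only [carlitzTails, carlitzWordsOfContent, Set.mem_sdiff, Set.mem_ofPred_eq, hcount,
    Set.mem_image]
  cases l with
  | nil => simp
  | cons a l =>
    simp only [List.isChain_cons_cons, List.cons.injEq]
    constructor
    · rintro ⟨h1, h2, h3⟩
      refine ⟨⟨h1, h3⟩, ?_⟩
      rintro ⟨x, -, h4, -⟩
      exact h2 h4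
    · rintro ⟨⟨h1, h2⟩, h3⟩
      refine ⟨h1, ?_, h2⟩
      rintro rfl
      exact h3 ⟨l, ⟨h1, h2⟩, rfl, rfl⟩

theorem ncard_carlitzTails_add [Fintype α] {m : α → ℕ} {c : α} {k : ℕ} (h : m c = k + 1) :
    (carlitzTails m c).ncard + (carlitzTails (Function.update m c k) c).ncard =
      (carlitzWordsOfContent (Function.update m c k)).ncard := by
  rw [carlitzTails_eq_diff h,
    ← Set.ncard_image_of_injective (carlitzTails (Function.update m c k) c)
      (List.cons_injective (a := c))]
  refine Set.ncard_sdiff_add_ncard_of_subset ?_ (carlitzWordsOfContent_finite _)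
  rintro _ ⟨l, hl, rfl⟩
  exact hl

theorem ncard_carlitzWordsOfContent [Fintype α] {m : α → ℕ} {c : α} (h : m c ≠ 0) :
    (carlitzWordsOfContent m).ncard = ∑ a, (carlitzTails m a).ncard := by
  have hU : carlitzWordsOfContent m = ⋃ a, List.cons a '' carlitzTails m a := by
    ext l
    simp only [Set.mem_iUnion, Set.mem_image]
    constructor
    · intro hl
      cases l with
      | nil => exact absurd (by simpa using (hl.1 c).symm) h
      | cons a l => exact ⟨a, l, hl, rfl⟩
    · rintro ⟨a, l, hl, rfl⟩
      exact hl
  rw [hU, Set.ncard_iUnion_of_finite (fun a => (carlitzTails_finite m a).image _),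
    finsum_eq_sum_of_fintype]
  · exact Finset.sum_congr rfl fun a _ => Set.ncard_image_of_injective _ List.cons_injective
  · intro a b hab
    refine Set.disjoint_left.2 ?_
    rintro _ ⟨l, -, rfl⟩ ⟨l₂, -, heq⟩
    exact hab (List.cons.inj heq).1.symm

end Words

/-! ### The functional `Φ` and the polynomials `P_k` -/

section Functional

open Polynomial

/-- This is integration by parts for `Φ(p) = ∫₀^∞ p(t) e^{-t} dt`; on monomials it reads `m * (m -
1)! = m!`. -/
theorem factorialFunctional_derivative (p : ℚ[X]) :
    factorialFunctional (derivative p) = factorialFunctional p - p.coeff 0 := by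
  induction p using Polynomial.induction_on' with
  | add p q hp hq => simp only [map_add, hp, hq, coeff_add]; ring
  | monomial n a =>
    rw [derivative_monomial, ← smul_X_eq_monomial, ← smul_X_eq_monomial, map_smul, map_smul,
      factorialFunctional_X_pow, factorialFunctional_X_pow]
    cases n with
    | zero => simp
    | succ n => simp [Nat.factorial_succ]; ring

/-- The antiderivative of a polynomial with zero constant term. -/
noncomputable def antiderivative (p : ℚ[X]) : ℚ[X] :=
  p.sum fun n a => monomial (n + 1) (a / (n + 1))

theorem derivative_antiderivative (p : ℚ[X]) : derivative (antiderivative p) = p := by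
  conv_rhs => rw [← p.sum_monomial_eq]
  simp only [antiderivative, Polynomial.sum, derivative_sum, derivative_monomial]
  refine Finset.sum_congr rfl fun n _ => ?_
  congr 1
  push_cast
  field_simp

theorem coeff_zero_antiderivative (p : ℚ[X]) : (antiderivative p).coeff 0 = 0 := by
  simp [antiderivative, Polynomial.sum, coeff_monomial]

theorem eq_antiderivative {p q : ℚ[X]} (h : derivative q = p) (h0 : q.coeff 0 = 0) :
    antiderivative p = q := by
  have hd : derivative (antiderivative p - q) = 0 := by
    rw [derivative_sub, derivative_antiderivative, h, sub_self]
  have h1 := eq_C_of_derivative_eq_zero hd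
  rw [coeff_sub, coeff_zero_antiderivative, h0, sub_zero, C_0] at h1
  exact sub_eq_zero.1 h1

/-- The polynomials with generating function
`∑ carlitzPoly m * x ^ m = exp (X * x / (1 + x))`. -/
noncomputable def carlitzPoly : ℕ → ℚ[X]
  | 0 => 1
  | m + 1 => antiderivative (carlitzPoly m - derivative (carlitzPoly m))

theorem derivative_carlitzPoly_succ (m : ℕ) :
    derivative (carlitzPoly (m + 1)) = carlitzPoly m - derivative (carlitzPoly m) :=
  derivative_antiderivative _

theorem carlitzPoly_four :
    carlitzPoly 4 = C (1 / 24 : ℚ) * X ^ 4 - C (1 / 2 : ℚ) * X ^ 3 + C (3 / 2 : ℚ) * X ^ 2 - X := by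
  have h1 : carlitzPoly 1 = X := eq_antiderivative (by simp [carlitzPoly]) (by simp)
  have h2 : carlitzPoly 2 = C (1 / 2 : ℚ) * X ^ 2 - X := by
    refine eq_antiderivative ?_ (by simp)
    rw [h1]
    refine Polynomial.funext fun x => ?_
    simp
    ring
  have h3 : carlitzPoly 3 = C (1 / 6 : ℚ) * X ^ 3 - X ^ 2 + X := by
    refine eq_antiderivative ?_ (by simp)
    rw [h2]
    refine Polynomial.funext fun x => ?_
    simp
    ring
  refine eq_antiderivative ?_ (by simp)
  rw [h3]
  refine Polynomial.funext fun x => ?_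
  simp
  ring

end Functional

/-! ### Counting words of arbitrary content -/

section Counting

open Polynomial

variable {α : Type*} [DecidableEq α] [Fintype α]

theorem ncard_carlitzTails_eq {m : α → ℕ} {c : α}
    (ih : ∀ k, m c = k + 1 →
      ((carlitzWordsOfContent (Function.update m c k)).ncard : ℚ) =
          factorialFunctional (∏ i, carlitzPoly (Function.update m c k i)) ∧
        ((carlitzTails (Function.update m c k) c).ncard : ℚ) =
          factorialFunctional ((∏ i ∈ Finset.univ.erase c,
            carlitzPoly (Function.update m c k i)) *
              derivative (carlitzPoly (Function.update m c k c)))) :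
    ((carlitzTails m c).ncard : ℚ) =
      factorialFunctional
        ((∏ i ∈ Finset.univ.erase c, carlitzPoly (m i)) * derivative (carlitzPoly (m c))) := by
  rcases hk : m c with _ | k
  -- No word starts with an absent letter, and `P_0 = 1` has derivative zero.
  · simp [carlitzTails_eq_empty hk, carlitzPoly]
  · obtain ⟨hW, hT⟩ := ih k hk
    have hrest : ∏ i ∈ Finset.univ.erase c, carlitzPoly (Function.update m c k i) =
        ∏ i ∈ Finset.univ.erase c, carlitzPoly (m i) :=
      Finset.prod_congr rfl fun i hi => by
        rw [Function.update_of_ne (Finset.ne_of_mem_erase hi)]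
    rw [← Finset.prod_erase_mul _ _ (Finset.mem_univ c), hrest, Function.update_self] at hW
    rw [hrest, Function.update_self] at hT
    have hadd : ((carlitzTails m c).ncard : ℚ) +
        (carlitzTails (Function.update m c k) c).ncard =
          (carlitzWordsOfContent (Function.update m c k)).ncard := by
      exact_mod_cast ncard_carlitzTails_add hk
    rw [derivative_carlitzPoly_succ, mul_sub, map_sub, ← hW, ← hT, ← hadd]
    ring

theorem ncard_carlitzWordsOfContent_eq_sum {m : α → ℕ}
    (h : ∀ c, ((carlitzTails m c).ncard : ℚ) =
      factorialFunctional
        ((∏ i ∈ Finset.univ.erase c, carlitzPoly (m i)) * derivative (carlitzPoly (m c)))) :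
    ((carlitzWordsOfContent m).ncard : ℚ) = factorialFunctional (∏ i, carlitzPoly (m i)) := by
  by_cases hm : ∃ c, m c ≠ 0
  · obtain ⟨c, hc⟩ := hm
    obtain ⟨k, hk⟩ := Nat.exists_eq_succ_of_ne_zero hc
    -- A letter that occurs contributes a factor with zero constant term, so the boundary term of
    -- `Φ` vanishes.
    have h0 : (∏ i, carlitzPoly (m i)).coeff 0 = 0 := by
      rw [← Finset.prod_erase_mul _ _ (Finset.mem_univ c), mul_coeff_zero, hk]
      simp [carlitzPoly, coeff_zero_antiderivative]
    rw [ncard_carlitzWordsOfContent hc, Nat.cast_sum, Finset.sum_congr rfl fun c _ => h c,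
      ← map_sum, ← derivative_prod_finset, factorialFunctional_derivative, h0, sub_zero]
  · push Not at hm
    obtain rfl : m = fun _ => 0 := funext hm
    simpa [carlitzWordsOfContent_zero, carlitzPoly] using (factorialFunctional_X_pow 0).symm

/-- The number of Carlitz words of a given content. -/
theorem ncard_carlitzWordsOfContent_eq (m : α → ℕ) :
    ((carlitzWordsOfContent m).ncard : ℚ) = factorialFunctional (∏ i, carlitzPoly (m i)) := by
  refine ncard_carlitzWordsOfContent_eq_sum fun c => ?_
  -- Induction on word length; the word count for smaller content follows from its tail counts.
  induction hN : ∑ i, m i using Nat.strong_induction_on generalizing m c with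
  | _ N ih =>
    refine ncard_carlitzTails_eq fun k hk => ?_
    have hlt : ∑ i, Function.update m c k i < N := by
      rw [← hN]
      refine Finset.sum_lt_sum (fun i _ => ?_) ⟨c, Finset.mem_univ c, by simp [hk]⟩
      by_cases hi : i = c
      · subst hi
        simp [hk]
      · simp [hi]
    have hT := fun a => ih _ hlt (Function.update m c k) a rfl
    exact ⟨ncard_carlitzWordsOfContent_eq_sum hT, hT c⟩

theorem carlitzCount_eq_factorialFunctional (k n : ℕ) :
    (carlitzCount k n : ℚ) = factorialFunctional (carlitzPoly k ^ n) := by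
  have h := ncard_carlitzWordsOfContent_eq (fun _ : Fin n => k)
  rwa [Finset.prod_const, Finset.card_univ, Fintype.card_fin] at h

end Counting

theorem factorialFunctional_pow_eq_sum (n : ℕ) :
    factorialFunctional
        ((Polynomial.C (1 / 24 : ℚ) * Polynomial.X ^ 4 - Polynomial.C (1 / 2 : ℚ) * Polynomial.X ^ 3
          + Polynomial.C (3 / 2 : ℚ) * Polynomial.X ^ 2 - Polynomial.X) ^ n) =
      ∑ p ∈ Finset.piAntidiag (Finset.univ : Finset (Fin 5)) n,
        (-1 : ℚ) ^ (p 1 + p 4) * (Nat.multinomial Finset.univ p : ℚ) *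
          (((4 * p 0 + 3 * p 1 + 2 * p 2 + 2 * p 3 + p 4)! : ℕ) : ℚ) /
            (((4 ! : ℕ) : ℚ) ^ p 0 * ((2 ! : ℕ) : ℚ) ^ (p 3 + p 1)) := by
  -- The coefficient `3/2` of `X ^ 2` is split as `1 + 1/2`, which yields the separate indices `u`
  -- and `v`.
  let coef : Fin 5 → ℚ := ![1 / 24, -(1 / 2), 1, 1 / 2, -1]
  let expo : Fin 5 → ℕ := ![4, 3, 2, 2, 1]
  have hsum : Polynomial.C (1 / 24 : ℚ) * Polynomial.X ^ 4
      - Polynomial.C (1 / 2 : ℚ) * Polynomial.X ^ 3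
      + Polynomial.C (3 / 2 : ℚ) * Polynomial.X ^ 2 - Polynomial.X =
        ∑ i, Polynomial.C (coef i) * Polynomial.X ^ expo i := by
    refine Polynomial.funext fun x => ?_
    simp [coef, expo, Fin.sum_univ_five]
    ring
  rw [hsum, Finset.sum_pow_eq_sum_piAntidiag, map_sum]
  refine Finset.sum_congr rfl fun p _ => ?_
  have hterm : (Nat.multinomial Finset.univ p : ℚ[X]) *
      ∏ i, (Polynomial.C (coef i) * Polynomial.X ^ expo i) ^ p i =
        ((Nat.multinomial Finset.univ p : ℚ) * ∏ i, coef i ^ p i) •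
          Polynomial.X ^ ∑ i, expo i * p i := by
    simp only [mul_pow, Finset.prod_mul_distrib, ← pow_mul, Finset.prod_pow_eq_pow_sum,
      Polynomial.smul_eq_C_mul, map_mul, map_prod, map_pow, map_natCast, mul_assoc]
  rw [hterm, map_smul, factorialFunctional_X_pow]
  simp only [Fin.sum_univ_five, Fin.prod_univ_five, coef, expo, Matrix.cons_val, one_mul,
    smul_eq_mul, one_pow, mul_one]
  rw [neg_pow (1 / 2 : ℚ), show (4 ! : ℕ) = 24 from rfl, show (2 ! : ℕ) = 2 from rfl]
  simp only [pow_add, one_div, inv_pow, Nat.cast_ofNat]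
  field_simp

/-- In the sum, `p = (s, t, u, v, w)` runs over the 5-tuples of natural numbers with
`s + t + u + v + w = n`. -/
theorem mainTheorem3 (n : ℕ) :
    (carlitzCount 4 n : ℚ) =
        ∑ p ∈ Finset.piAntidiag (Finset.univ : Finset (Fin 5)) n,
          (-1 : ℚ) ^ (p 1 + p 4) * (Nat.multinomial Finset.univ p : ℚ) *
            (((4 * p 0 + 3 * p 1 + 2 * p 2 + 2 * p 3 + p 4)! : ℕ) : ℚ) /
              (((4 ! : ℕ) : ℚ) ^ p 0 * ((2 ! : ℕ) : ℚ) ^ (p 3 + p 1)) ∧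
      (carlitzCount 4 n : ℚ) =
        factorialFunctional
          ((Polynomial.C (1 / 24 : ℚ) * Polynomial.X ^ 4 - Polynomial.C (1 / 2 : ℚ) * Polynomial.X ^ 3
            + Polynomial.C (3 / 2 : ℚ) * Polynomial.X ^ 2 - Polynomial.X) ^ n) := by
  have h := carlitzCount_eq_factorialFunctional 4 n
  rw [carlitzPoly_four] at h
  exact ⟨h.trans (factorialFunctional_pow_eq_sum n), h⟩
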